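/- For $\theta,s,h>0$ let $\mathcal S_{\theta,h}^s(\mathbf R^d)$ be the space of all $f\in C^\infty(\mathbf R^d)$ (complex valued) such that $$\|f\|_{\mathcal S_{\theta,h}^s}=\sup_{\alpha,\beta\in\mathbf N^d,\ x\in\mathbf R^d}\frac{|x^\alpha D^\beta f(x)|}{h^{|\alpha+\beta|}\,\alpha!^\theta\,\beta!^s}<\infty ,$$ normed by $\|\cdot\|_{\mathcal S_{\theta,h}^s}$. Let $\mathcal S_\theta^s(\mathbf R^d)=\bigcup_{h>0}\mathcal S_{\theta,h}^s(\mathbf R^d)$ (Roumieu type Gelfand--Shilov space) carry the locally convex inductive limit topology, and let $\Sigma_\theta^s(\mathbf R^d)=\bigcap_{h>0}\mathcal S_{\theta,h}^s(\mathbf R^d)$ (Beurling type Gelfand--Shilov space) carry the projective limit topology, i.e. the topology defined by the norms $\|\cdot\|_{\mathcal S_{\theta,h}^s}$, $h>0$. **Theorem 1.1.** Let $q$ be a polynomial on $\mathbf R^d$ with real coefficients and degree $m\ge 2$, let $(Tf)(x)=e^{iq(x)}f(x)$ for $x\in\mathbf R^d$, and let $s,\theta>0$. (i) If $s\ge (m-1)\theta\ge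 1$, then $T$ maps $\mathcal S_\theta^s(\mathbf R^d)$ into itself and is continuous on $\mathcal S_\theta^s(\mathbf R^d)$. (ii) If $s\ge (m-1)\theta\ge 1$ and $(\theta,s)\ne\left(\frac1{m-1},1\right)$, then $T$ maps $\Sigma_\theta^s(\mathbf R^d)$ into itself and is continuous on $\Sigma_\theta^s(\mathbf R^d)$. -/

import Mathlib

noncomputable section

namespace GelfandShilov

open scoped ContDiff Topology

/-- The Euclidean space `ℝᵈ`. -/
abbrev Rd (d : ℕ) : Type := EuclideanSpace ℝ (Fin d)

/-- The `j`-th partial derivative `∂_j f` of a function on `ℝᵈ`. -/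
def partialDeriv {d : ℕ} (j : Fin d) (f : Rd d → ℂ) : Rd d → ℂ :=
  fun x => fderiv ℝ f x (EuclideanSpace.single j 1)

/-- The derivative `∂_{j₁}^{β j₁} ⋯ ∂_{jₖ}^{β jₖ} f` along a list `[j₁, …, jₖ]` of coordinates. -/
def listDeriv {d : ℕ} (β : Fin d → ℕ) (l : List (Fin d)) (f : Rd d → ℂ) : Rd d → ℂ :=
  l.foldr (fun j g => (partialDeriv j)^[β j] g) f

/-- The partial derivative `∂^β f = ∂_1^{β_1} ⋯ ∂_d^{β_d} f` for a multi-index `β ∈ ℕᵈ`. -/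
def multiDeriv {d : ℕ} (β : Fin d → ℕ) (f : Rd d → ℂ) : Rd d → ℂ :=
  listDeriv β (List.finRange d) f

/-- The length `|α| = α_1 + ⋯ + α_d` of a multi-index. -/
def multiLength {d : ℕ} (α : Fin d → ℕ) : ℕ := ∑ j, α j

/-- The factorial `α! = α_1! ⋯ α_d!` of a multi-index. -/
def multiFactorial {d : ℕ} (α : Fin d → ℕ) : ℕ := ∏ j, (α j).factorial

/-- The monomial `x^α`. -/
def multiPow {d : ℕ} (x : Rd d) (α : Fin d → ℕ) : ℝ := ∏ j, x j ^ α j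

/-- The quotient `|x^α D^β f(x)| / (h^{|α+β|} α!^θ β!^s)` at `p = (α, β, x)`. Here
`D^β = i^{-|β|} ∂^β`, so that `|D^β f(x)| = |∂^β f(x)|`. -/
def gsQuotient {d : ℕ} (θ s h : ℝ) (f : Rd d → ℂ)
    (p : (Fin d → ℕ) × (Fin d → ℕ) × Rd d) : ℝ :=
  |multiPow p.2.2 p.1| * ‖multiDeriv p.2.1 f p.2.2‖ /
    (h ^ multiLength (p.1 + p.2.1) *
      (multiFactorial p.1 : ℝ) ^ θ * (multiFactorial p.2.1 : ℝ) ^ s)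

section Helpers

variable {d : ℕ}

theorem partialDeriv_contDiff (j : Fin d) {f : Rd d → ℂ} (hf : ContDiff ℝ ∞ f) :
    ContDiff ℝ ∞ (partialDeriv j f) :=
  (hf.fderiv_right (m := ∞) (by simp)).clm_apply contDiff_const

theorem partialDeriv_add (j : Fin d) {f g : Rd d → ℂ} (hf : ContDiff ℝ ∞ f)
    (hg : ContDiff ℝ ∞ g) : partialDeriv j (f + g) = partialDeriv j f + partialDeriv j g := by
  funext x
  simp [partialDeriv, fderiv_add (hf.differentiable (by simp) x) (hg.differentiable (by simp) x)]

theorem partialDeriv_smul (j : Fin d) (c : ℂ) {f : Rd d → ℂ} (hf : ContDiff ℝ ∞ f) :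
    partialDeriv j (c • f) = c • partialDeriv j f := by
  funext x
  simp [partialDeriv, fderiv_const_smul (hf.differentiable (by simp) x) c]

theorem iterate_contDiff (j : Fin d) (n : ℕ) {f : Rd d → ℂ} (hf : ContDiff ℝ ∞ f) :
    ContDiff ℝ ∞ ((partialDeriv j)^[n] f) := by
  induction n with
  | zero => exact hf
  | succ n ih => rw [Function.iterate_succ_apply']; exact partialDeriv_contDiff j ih

theorem iterate_add (j : Fin d) (n : ℕ) {f g : Rd d → ℂ} (hf : ContDiff ℝ ∞ f)
    (hg : ContDiff ℝ ∞ g) :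
    (partialDeriv j)^[n] (f + g) = (partialDeriv j)^[n] f + (partialDeriv j)^[n] g := by
  induction n with
  | zero => rfl
  | succ n ih =>
    simp only [Function.iterate_succ_apply']
    rw [ih, partialDeriv_add j (iterate_contDiff j n hf) (iterate_contDiff j n hg)]

theorem iterate_smul (j : Fin d) (n : ℕ) (c : ℂ) {f : Rd d → ℂ} (hf : ContDiff ℝ ∞ f) :
    (partialDeriv j)^[n] (c • f) = c • (partialDeriv j)^[n] f := by
  induction n with
  | zero => rfl
  | succ n ih =>
    simp only [Function.iterate_succ_apply']
    rw [ih, partialDeriv_smul j c (iterate_contDiff j n hf)]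

theorem listDeriv_contDiff (β : Fin d → ℕ) (l : List (Fin d)) {f : Rd d → ℂ}
    (hf : ContDiff ℝ ∞ f) : ContDiff ℝ ∞ (listDeriv β l f) := by
  induction l with
  | nil => exact hf
  | cons j l ih => exact iterate_contDiff j (β j) ih

theorem listDeriv_add (β : Fin d → ℕ) (l : List (Fin d)) {f g : Rd d → ℂ}
    (hf : ContDiff ℝ ∞ f) (hg : ContDiff ℝ ∞ g) :
    listDeriv β l (f + g) = listDeriv β l f + listDeriv β l g := by
  induction l with
  | nil => rfl
  | cons j l ih =>
    change (partialDeriv j)^[β j] (listDeriv β l (f + g)) = _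
    rw [ih, iterate_add j (β j) (listDeriv_contDiff β l hf) (listDeriv_contDiff β l hg)]
    rfl

theorem listDeriv_smul (β : Fin d → ℕ) (l : List (Fin d)) (c : ℂ) {f : Rd d → ℂ}
    (hf : ContDiff ℝ ∞ f) : listDeriv β l (c • f) = c • listDeriv β l f := by
  induction l with
  | nil => rfl
  | cons j l ih =>
    change (partialDeriv j)^[β j] (listDeriv β l (c • f)) = _
    rw [ih, iterate_smul j (β j) c (listDeriv_contDiff β l hf)]
    rfl

theorem listDeriv_zero_index (l : List (Fin d)) (f : Rd d → ℂ) : listDeriv 0 l f = f := by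
  induction l with
  | nil => rfl
  | cons j l ih =>
    change (partialDeriv j)^[0] (listDeriv 0 l f) = f
    rw [ih]
    rfl

theorem gsDenominator_pos (θ s : ℝ) {h : ℝ} (hh : 0 < h) (α β : Fin d → ℕ) :
    0 < h ^ multiLength (α + β) *
      (multiFactorial α : ℝ) ^ θ * (multiFactorial β : ℝ) ^ s := by
  have key : ∀ γ : Fin d → ℕ, (0 : ℝ) < multiFactorial γ := fun γ => by
    exact_mod_cast Finset.prod_pos fun j _ => Nat.factorial_pos (γ j)
  have h1 := Real.rpow_pos_of_pos (key α) θ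
  have h2 := Real.rpow_pos_of_pos (key β) s
  positivity

theorem gsQuotient_nonneg (θ s : ℝ) {h : ℝ} (hh : 0 < h) (f : Rd d → ℂ)
    (p : (Fin d → ℕ) × (Fin d → ℕ) × Rd d) : 0 ≤ gsQuotient θ s h f p :=
  div_nonneg (by positivity) (gsDenominator_pos θ s hh _ _).le

theorem gsQuotient_add_le (θ s : ℝ) {h : ℝ} (hh : 0 < h) {f g : Rd d → ℂ}
    (hf : ContDiff ℝ ∞ f) (hg : ContDiff ℝ ∞ g) (p : (Fin d → ℕ) × (Fin d → ℕ) × Rd d) :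
    gsQuotient θ s h (f + g) p ≤ gsQuotient θ s h f p + gsQuotient θ s h g p := by
  have hD := gsDenominator_pos θ s hh p.1 p.2.1
  unfold gsQuotient multiDeriv
  rw [listDeriv_add _ _ hf hg, ← add_div, ← mul_add]
  gcongr
  exact norm_add_le _ _

theorem gsQuotient_smul (θ s h : ℝ) (c : ℂ) {f : Rd d → ℂ} (hf : ContDiff ℝ ∞ f)
    (p : (Fin d → ℕ) × (Fin d → ℕ) × Rd d) :
    gsQuotient θ s h (c • f) p = ‖c‖ * gsQuotient θ s h f p := by
  unfold gsQuotient multiDeriv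
  rw [listDeriv_smul _ _ c hf, Pi.smul_apply, norm_smul]
  ring

theorem gsQuotient_anti (θ s : ℝ) {h k : ℝ} (hh : 0 < h) (hk : h ≤ k) (f : Rd d → ℂ)
    (p : (Fin d → ℕ) × (Fin d → ℕ) × Rd d) :
    gsQuotient θ s k f p ≤ gsQuotient θ s h f p := by
  have hD := gsDenominator_pos θ s hh p.1 p.2.1
  unfold gsQuotient
  gcongr

theorem gsQuotient_zero_index (θ s h : ℝ) (f : Rd d → ℂ) (x : Rd d) :
    gsQuotient θ s h f (0, 0, x) = ‖f x‖ := by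
  simp [gsQuotient, multiDeriv, listDeriv_zero_index, multiPow, multiLength, multiFactorial]

end Helpers

variable (d : ℕ) (θ s : ℝ)

/-- The functions `f ∈ C^∞(ℝᵈ)` for which `|x^α D^β f(x)| / (h^{|α+β|} α!^θ β!^s)` is bounded over
all `α, β ∈ ℕᵈ` and `x ∈ ℝᵈ`, where `h > 0`. -/
def stepSubmodule (h : Set.Ioi (0 : ℝ)) : Submodule ℂ (Rd d → ℂ) where
  carrier := {f | ContDiff ℝ ∞ f ∧ BddAbove (Set.range (gsQuotient θ s h f))}
  zero_mem' := by
    refine ⟨contDiff_const, 0, ?_⟩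
    rintro _ ⟨p, rfl⟩
    have := gsQuotient_smul θ s h 0 (contDiff_const : ContDiff ℝ ∞ (0 : Rd d → ℂ)) p
    simp only [zero_smul, norm_zero, zero_mul] at this
    exact this.le
  add_mem' := by
    rintro f g ⟨hf, A, hA⟩ ⟨hg, B, hB⟩
    refine ⟨hf.add hg, A + B, ?_⟩
    rintro _ ⟨p, rfl⟩
    exact (gsQuotient_add_le θ s h.2 hf hg p).trans (add_le_add (hA ⟨p, rfl⟩) (hB ⟨p, rfl⟩))
  smul_mem' := by
    rintro c f ⟨hf, A, hA⟩
    refine ⟨contDiff_const.smul hf, ‖c‖ * A, ?_⟩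
    rintro _ ⟨p, rfl⟩
    rw [gsQuotient_smul θ s h c hf p]
    exact mul_le_mul_of_nonneg_left (hA ⟨p, rfl⟩) (norm_nonneg c)

theorem stepSubmodule_mono {h k : Set.Ioi (0 : ℝ)} (hk : h ≤ k) :
    stepSubmodule d θ s h ≤ stepSubmodule d θ s k := by
  rintro f ⟨hf, A, hA⟩
  refine ⟨hf, A, ?_⟩
  rintro _ ⟨p, rfl⟩
  exact (gsQuotient_anti θ s h.2 hk f p).trans (hA ⟨p, rfl⟩)

/-- The normed space `𝒮_{θ,h}^s(ℝᵈ)`. (A separate type, so that it does not inherit the topology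
of pointwise convergence.) -/
def StepSpace (h : Set.Ioi (0 : ℝ)) : Type := stepSubmodule d θ s h

instance (h : Set.Ioi (0 : ℝ)) : AddCommGroup (StepSpace d θ s h) :=
  inferInstanceAs (AddCommGroup (stepSubmodule d θ s h))

instance (h : Set.Ioi (0 : ℝ)) : Module ℂ (StepSpace d θ s h) :=
  inferInstanceAs (Module ℂ (stepSubmodule d θ s h))

/-- `‖f‖ = sup_{α, β, x} |x^α D^β f(x)| / (h^{|α+β|} α!^θ β!^s)`. -/
instance (h : Set.Ioi (0 : ℝ)) : Norm (StepSpace d θ s h) where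
  norm f := ⨆ p, gsQuotient θ s h f.1 p

theorem stepSpace_core (h : Set.Ioi (0 : ℝ)) : NormedSpace.Core ℂ (StepSpace d θ s h) where
  norm_nonneg f := Real.iSup_nonneg fun p => gsQuotient_nonneg θ s h.2 f.1 p
  norm_smul c f := by
    change (⨆ p, gsQuotient θ s h (c • f.1) p) = ‖c‖ * ⨆ p, gsQuotient θ s h f.1 p
    simp_rw [gsQuotient_smul θ s h c f.2.1]
    exact (Real.mul_iSup_of_nonneg (norm_nonneg c) _).symm
  norm_triangle f g := by
    refine ciSup_le fun p => (gsQuotient_add_le θ s h.2 f.2.1 g.2.1 p).trans ?_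
    exact add_le_add (le_ciSup f.2.2 p) (le_ciSup g.2.2 p)
  norm_eq_zero_iff f := by
    constructor
    · intro h0
      refine Subtype.ext (funext fun x => ?_)
      have h1 := le_ciSup f.2.2 (0, 0, x)
      rw [gsQuotient_zero_index] at h1
      exact norm_le_zero_iff.1 (h1.trans h0.le)
    · rintro rfl
      change (⨆ p, gsQuotient θ s h (0 : Rd d → ℂ) p) = 0
      have h1 := fun p =>
        gsQuotient_smul θ s h 0 (contDiff_const : ContDiff ℝ ∞ (0 : Rd d → ℂ)) p
      simp only [zero_smul, norm_zero, zero_mul] at h1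
      simp [h1]

instance (h : Set.Ioi (0 : ℝ)) : NormedAddCommGroup (StepSpace d θ s h) :=
  NormedAddCommGroup.ofCore (stepSpace_core d θ s h)

instance (h : Set.Ioi (0 : ℝ)) : NormedSpace ℂ (StepSpace d θ s h) :=
  NormedSpace.ofCore (stepSpace_core d θ s h)

/-- The intersection of all `𝒮_{θ,h}^s(ℝᵈ)`, `h > 0`. -/
def beurlingSubmodule : Submodule ℂ (Rd d → ℂ) := ⨅ h, stepSubmodule d θ s h

/-- The union of all `𝒮_{θ,h}^s(ℝᵈ)`, `h > 0`. -/
def roumieuSubmodule : Submodule ℂ (Rd d → ℂ) where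
  carrier := ⋃ h, (stepSubmodule d θ s h : Set (Rd d → ℂ))
  zero_mem' := Set.mem_iUnion.2 ⟨⟨1, Set.mem_Ioi.2 one_pos⟩, Submodule.zero_mem _⟩
  add_mem' := by
    intro f g hf hg
    obtain ⟨h, hf⟩ := Set.mem_iUnion.1 hf
    obtain ⟨k, hg⟩ := Set.mem_iUnion.1 hg
    exact Set.mem_iUnion.2 ⟨max h k, Submodule.add_mem _
      (stepSubmodule_mono d θ s (le_max_left h k) hf)
      (stepSubmodule_mono d θ s (le_max_right h k) hg)⟩
  smul_mem' := by
    intro c f hf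
    obtain ⟨h, hf⟩ := Set.mem_iUnion.1 hf
    exact Set.mem_iUnion.2 ⟨h, Submodule.smul_mem _ c hf⟩

/-- The Beurling type Gelfand–Shilov space `Σ_θ^s(ℝᵈ)`. -/
def BeurlingSpace : Type := beurlingSubmodule d θ s

instance : AddCommGroup (BeurlingSpace d θ s) :=
  inferInstanceAs (AddCommGroup (beurlingSubmodule d θ s))

instance : Module ℂ (BeurlingSpace d θ s) :=
  inferInstanceAs (Module ℂ (beurlingSubmodule d θ s))

instance : FunLike (BeurlingSpace d θ s) (Rd d) ℂ where
  coe f := f.1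
  coe_injective := Subtype.val_injective

/-- The inclusion `Σ_θ^s(ℝᵈ) ⊆ 𝒮_{θ,h}^s(ℝᵈ)`. -/
def beurlingToStep (h : Set.Ioi (0 : ℝ)) : BeurlingSpace d θ s →ₗ[ℂ] StepSpace d θ s h :=
  Submodule.inclusion (iInf_le (stepSubmodule d θ s) h)

/-- The projective limit topology: the topology defined by the norms of all `𝒮_{θ,h}^s(ℝᵈ)`,
`h > 0`. -/
instance : TopologicalSpace (BeurlingSpace d θ s) :=
  ⨅ h, TopologicalSpace.induced (beurlingToStep d θ s h) inferInstance

/-- The Roumieu type Gelfand–Shilov space `𝒮_θ^s(ℝᵈ)`. -/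
def RoumieuSpace : Type := roumieuSubmodule d θ s

instance : AddCommGroup (RoumieuSpace d θ s) :=
  inferInstanceAs (AddCommGroup (roumieuSubmodule d θ s))

instance : Module ℂ (RoumieuSpace d θ s) :=
  inferInstanceAs (Module ℂ (roumieuSubmodule d θ s))

instance : FunLike (RoumieuSpace d θ s) (Rd d) ℂ where
  coe f := f.1
  coe_injective := Subtype.val_injective

/-- The inclusion `𝒮_{θ,h}^s(ℝᵈ) ⊆ 𝒮_θ^s(ℝᵈ)`. -/
def stepToRoumieu (h : Set.Ioi (0 : ℝ)) : StepSpace d θ s h →ₗ[ℂ] RoumieuSpace d θ s :=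
  Submodule.inclusion (Set.subset_iUnion (fun k => (stepSubmodule d θ s k : Set (Rd d → ℂ))) h)

/-- The (locally convex) inductive limit topology: the strongest locally convex vector space
topology for which all the inclusions `𝒮_{θ,h}^s(ℝᵈ) ⊆ 𝒮_θ^s(ℝᵈ)`, `h > 0`, are continuous. In
Mathlib's order of topologies the strongest one is the infimum. -/
instance : TopologicalSpace (RoumieuSpace d θ s) :=
  sInf {t : TopologicalSpace (RoumieuSpace d θ s) |
    (∀ h, Continuous[inferInstance, t] (stepToRoumieu d θ s h)) ∧
    @IsTopologicalAddGroup (RoumieuSpace d θ s) t _ ∧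
    @ContinuousSMul ℂ (RoumieuSpace d θ s) _ _ t ∧
    @LocallyConvexSpace ℝ (RoumieuSpace d θ s) _ _ _ _ t}

end GelfandShilov

end

noncomputable section

namespace GelfandShilov

open scoped ContDiff Topology

section Words

variable {d : ℕ}

/-- The derivative `∂_{j₁} ⋯ ∂_{jₙ} f` along a word `[j₁, …, jₙ]` of coordinates. -/
def wordDeriv (w : List (Fin d)) (f : Rd d → ℂ) : Rd d → ℂ := w.foldr partialDeriv f

theorem wordDeriv_nil (f : Rd d → ℂ) : wordDeriv [] f = f := rfl

theorem wordDeriv_cons (j : Fin d) (w : List (Fin d)) (f : Rd d → ℂ) :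
    wordDeriv (j :: w) f = partialDeriv j (wordDeriv w f) := rfl

theorem wordDeriv_append (u v : List (Fin d)) (f : Rd d → ℂ) :
    wordDeriv (u ++ v) f = wordDeriv u (wordDeriv v f) := List.foldr_append

theorem wordDeriv_contDiff (w : List (Fin d)) {f : Rd d → ℂ} (hf : ContDiff ℝ ∞ f) :
    ContDiff ℝ ∞ (wordDeriv w f) := by
  induction w with
  | nil => exact hf
  | cons j w ih => exact partialDeriv_contDiff j ih

theorem wordDeriv_smul (w : List (Fin d)) (c : ℂ) {f : Rd d → ℂ} (hf : ContDiff ℝ ∞ f) :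
    wordDeriv w (c • f) = c • wordDeriv w f := by
  induction w with
  | nil => rfl
  | cons j w ih =>
    rw [wordDeriv_cons, ih, partialDeriv_smul j c (wordDeriv_contDiff w hf), wordDeriv_cons]

theorem partialDeriv_zero (j : Fin d) : partialDeriv j (0 : Rd d → ℂ) = 0 := by
  funext x
  simp [partialDeriv]

theorem wordDeriv_zero (w : List (Fin d)) : wordDeriv w (0 : Rd d → ℂ) = 0 := by
  induction w with
  | nil => rfl
  | cons j w ih => rw [wordDeriv_cons, ih, partialDeriv_zero]

theorem partialDeriv_mul (j : Fin d) {f g : Rd d → ℂ} (hf : ContDiff ℝ ∞ f)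
    (hg : ContDiff ℝ ∞ g) :
    partialDeriv j (f * g) = partialDeriv j f * g + f * partialDeriv j g := by
  funext x
  simp only [partialDeriv, Pi.add_apply, Pi.mul_apply]
  rw [fderiv_mul (hf.differentiable (by simp) x) (hg.differentiable (by simp) x)]
  simp
  ring

theorem partialDeriv_list_sum {ι : Type*} (j : Fin d) (F : ι → Rd d → ℂ)
    (hF : ∀ i, ContDiff ℝ ∞ (F i)) (l : List ι) :
    ContDiff ℝ ∞ (l.map F).sum ∧
      partialDeriv j (l.map F).sum = (l.map fun i => partialDeriv j (F i)).sum := by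
  induction l with
  | nil => exact ⟨contDiff_const, partialDeriv_zero j⟩
  | cons i l ih =>
    simp only [List.map_cons, List.sum_cons]
    exact ⟨(hF i).add ih.1, by rw [partialDeriv_add j (hF i) ih.1, ih.2]⟩

/-- All ways of splitting a word into a subword and the complementary subword. -/
def splits {ι : Type*} : List ι → List (List ι × List ι)
  | [] => [([], [])]
  | j :: w => (splits w).map (fun p => (j :: p.1, p.2)) ++ (splits w).map fun p => (p.1, j :: p.2)

theorem length_add_of_mem_splits {ι : Type*} {w : List ι} {p : List ι × List ι}
    (hp : p ∈ splits w) : p.1.length + p.2.length = w.length := by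
  induction w generalizing p with
  | nil => simp [splits] at hp; simp [hp]
  | cons j w ih =>
    simp only [splits, List.mem_append, List.mem_map] at hp
    rcases hp with ⟨p, hp, rfl⟩ | ⟨p, hp, rfl⟩ <;> simp [← ih hp] <;> ring

theorem sublist_of_mem_splits {ι : Type*} {w : List ι} {p : List ι × List ι}
    (hp : p ∈ splits w) : p.2.Sublist w := by
  induction w generalizing p with
  | nil => simp [splits] at hp; simp [hp]
  | cons j w ih =>
    simp only [splits, List.mem_append, List.mem_map] at hp
    rcases hp with ⟨p, hp, rfl⟩ | ⟨p, hp, rfl⟩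
    · exact (ih hp).cons j
    · exact (ih hp).cons_cons j

theorem sum_splits_pow {ι : Type*} (a b : ℝ) (w : List ι) :
    ((splits w).map fun p => a ^ p.1.length * b ^ p.2.length).sum = (a + b) ^ w.length := by
  induction w with
  | nil => simp [splits]
  | cons j w ih =>
    simp only [splits, List.map_append, List.map_map, List.sum_append, List.length_cons,
      Function.comp_def, pow_succ _ w.length, ← ih, mul_add, ← List.sum_map_mul_right]
    congr 3 <;> funext p <;> ring

/-- The Leibniz rule. -/
theorem wordDeriv_mul {f g : Rd d → ℂ} (hf : ContDiff ℝ ∞ f) (hg : ContDiff ℝ ∞ g)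
    (w : List (Fin d)) :
    wordDeriv w (f * g) =
      ((splits w).map fun p => wordDeriv p.1 f * wordDeriv p.2 g).sum := by
  induction w with
  | nil => simp [splits, wordDeriv_nil]
  | cons j w ih =>
    rw [wordDeriv_cons, ih, (partialDeriv_list_sum j (fun p : List (Fin d) × List (Fin d) =>
      wordDeriv p.1 f * wordDeriv p.2 g) (fun p =>
      (wordDeriv_contDiff p.1 hf).mul (wordDeriv_contDiff p.2 hg)) (splits w)).2]
    simp only [splits, List.map_append, List.map_map, List.sum_append, Function.comp_def,
      wordDeriv_cons, ← List.sum_map_add]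
    congr 2
    funext p
    exact partialDeriv_mul j (wordDeriv_contDiff p.1 hf) (wordDeriv_contDiff p.2 hg)

theorem norm_wordDeriv_mul_le {f g : Rd d → ℂ} (hf : ContDiff ℝ ∞ f) (hg : ContDiff ℝ ∞ g)
    (w : List (Fin d)) (x : Rd d) (c a b : ℝ)
    (H : ∀ p ∈ splits w,
      ‖wordDeriv p.1 f x‖ * ‖wordDeriv p.2 g x‖ ≤ c * (a ^ p.1.length * b ^ p.2.length)) :
    ‖wordDeriv w (f * g) x‖ ≤ c * (a + b) ^ w.length := by
  rw [wordDeriv_mul hf hg, ← sum_splits_pow, ← List.sum_map_mul_left]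
  generalize splits w = l at H ⊢
  induction l with
  | nil => simp
  | cons p l ih =>
    simp only [List.map_cons, List.sum_cons, Pi.add_apply, Pi.mul_apply]
    refine (norm_add_le _ _).trans (add_le_add ?_ (ih fun p hp => H p (by simp [hp])))
    rw [norm_mul]
    exact H p (by simp)

/-- The increasing word containing each coordinate `j` exactly `β j` times. -/
def indexWord (β : Fin d → ℕ) : List (Fin d) :=
  (List.finRange d).flatMap fun j => List.replicate (β j) j

theorem wordDeriv_indexWord (β : Fin d → ℕ) (f : Rd d → ℂ) :
    wordDeriv (indexWord β) f = multiDeriv β f := by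
  unfold indexWord multiDeriv
  generalize List.finRange d = l
  induction l with
  | nil => rfl
  | cons j l ih =>
    rw [List.flatMap_cons, wordDeriv_append, ih]
    change _ = (partialDeriv j)^[β j] (listDeriv β l f)
    induction β j with
    | zero => rfl
    | succ n ihn =>
      rw [List.replicate_succ, wordDeriv_cons, ihn, Function.iterate_succ_apply']

theorem indexWord_sorted (β : Fin d → ℕ) : (indexWord β).Pairwise (· ≤ ·) := by
  rw [indexWord, List.pairwise_flatMap]
  refine ⟨fun j _ => List.pairwise_replicate.2 (Or.inr le_rfl),
    (List.pairwise_lt_finRange d).imp ?_⟩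
  intro i j hij a ha b hb
  rw [List.eq_of_mem_replicate ha, List.eq_of_mem_replicate hb]
  exact hij.le

theorem count_indexWord (β : Fin d → ℕ) (j : Fin d) : (indexWord β).count j = β j := by
  rw [indexWord, List.count_flatMap]
  simp only [Function.comp_def, List.count_replicate]
  rw [← List.ofFn_eq_map, List.sum_ofFn]
  simp

theorem length_eq_multiLength_count (w : List (Fin d)) :
    w.length = multiLength fun j => w.count j := by
  unfold multiLength
  induction w with
  | nil => simp
  | cons i w ih => simp [List.count_cons, Finset.sum_add_distrib, ih]

theorem length_indexWord (β : Fin d → ℕ) : (indexWord β).length = multiLength β := by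
  rw [length_eq_multiLength_count]
  simp [count_indexWord]

theorem wordDeriv_of_sorted {w : List (Fin d)} (hw : w.Pairwise (· ≤ ·)) (f : Rd d → ℂ) :
    wordDeriv w f = multiDeriv (fun j => w.count j) f := by
  rw [← wordDeriv_indexWord]
  congr 1
  refine List.Perm.eq_of_pairwise' hw (indexWord_sorted _) ?_
  exact List.perm_iff_count.2 fun j => (count_indexWord (fun i => w.count i) j).symm

end Words

section Polynomials

variable {d : ℕ}

/-- The complex valued polynomial function on `ℝᵈ`. -/
def polyFun (p : MvPolynomial (Fin d) ℝ) : Rd d → ℂ :=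
  fun x => ((MvPolynomial.eval (fun j => x j) p : ℝ) : ℂ)

theorem polyFun_contDiff (p : MvPolynomial (Fin d) ℝ) : ContDiff ℝ ∞ (polyFun p) := by
  refine Complex.ofRealCLM.contDiff.comp ?_
  induction p using MvPolynomial.induction_on with
  | C a => simpa using contDiff_const
  | add p q hp hq => simpa using hp.add hq
  | mul_X p j hp =>
    simpa using hp.mul (EuclideanSpace.proj (𝕜 := ℝ) j).contDiff

theorem partialDeriv_polyFun (j : Fin d) (p : MvPolynomial (Fin d) ℝ) :
    partialDeriv j (polyFun p) = polyFun (MvPolynomial.pderiv j p) := by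
  induction p using MvPolynomial.induction_on with
  | C a =>
    have h : polyFun (d := d) (MvPolynomial.C a) = fun _ => (a : ℂ) := by
      funext x; simp [polyFun]
    funext x
    simp [partialDeriv, h, polyFun]
  | add p q hp hq =>
    have h : ∀ p q : MvPolynomial (Fin d) ℝ, polyFun (p + q) = polyFun p + polyFun q :=
      fun p q => by funext x; simp [polyFun]
    rw [h, partialDeriv_add j (polyFun_contDiff p) (polyFun_contDiff q), hp, hq, map_add, h]
  | mul_X p i hp =>
    have h : ∀ p q : MvPolynomial (Fin d) ℝ, polyFun (p * q) = polyFun p * polyFun q :=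
      fun p q => by funext x; simp [polyFun]
    have hX : partialDeriv j (polyFun (MvPolynomial.X i)) =
        polyFun (MvPolynomial.pderiv j (MvPolynomial.X i)) := by
      funext x
      have h1 : polyFun (d := d) (MvPolynomial.X i) =
          Complex.ofRealCLM.comp (EuclideanSpace.proj (𝕜 := ℝ) i) := by
        funext x; simp [polyFun]
      rw [partialDeriv, h1, ContinuousLinearMap.fderiv]
      by_cases hij : i = j <;> simp [polyFun, MvPolynomial.pderiv_X, hij]
    rw [h, partialDeriv_mul j (polyFun_contDiff p) (polyFun_contDiff _), hp, hX,
      Derivation.leibniz, smul_eq_mul, smul_eq_mul]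
    funext x
    simp [polyFun]
    ring

theorem totalDegree_pderiv_le {σ R : Type*} [CommSemiring R] (j : σ) (p : MvPolynomial σ R) :
    (MvPolynomial.pderiv j p).totalDegree ≤ p.totalDegree - 1 := by
  classical
  conv_lhs => rw [p.as_sum, map_sum]
  refine MvPolynomial.totalDegree_finsetSum_le fun e he => ?_
  rw [MvPolynomial.pderiv_monomial]
  rcases Nat.eq_zero_or_pos (e j) with h0 | h0
  · simp [h0]
  · refine (MvPolynomial.totalDegree_monomial_le _ _).trans ?_
    have h1 := MvPolynomial.le_totalDegree he
    have h2 : (Finsupp.single j 1 : σ →₀ ℕ) ≤ e := by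
      rw [Finsupp.single_le_iff]; exact h0
    have h3 : ((e - Finsupp.single j 1 + Finsupp.single j 1).sum fun _ n => n) =
        e.sum fun _ n => n := by rw [tsub_add_cancel_of_le h2]
    rw [Finsupp.sum_add_index' (by simp) (by simp), Finsupp.sum_single_index rfl] at h3
    change (Finsupp.sum _ fun _ n => n) ≤ _
    omega

theorem exists_norm_polyFun_le (p : MvPolynomial (Fin d) ℝ) :
    ∃ C : ℝ, 0 ≤ C ∧ ∀ (x : Rd d) (Y : ℝ), 1 ≤ Y → (∀ j, |x j| ≤ Y) →
      ‖polyFun p x‖ ≤ C * Y ^ p.totalDegree := by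
  refine ⟨∑ e ∈ p.support, |p.coeff e|, by positivity, fun x Y hY hx => ?_⟩
  rw [polyFun, Complex.norm_real, Real.norm_eq_abs, MvPolynomial.eval_eq', Finset.sum_mul]
  refine (Finset.abs_sum_le_sum_abs _ _).trans (Finset.sum_le_sum fun e he => ?_)
  rw [abs_mul, Finset.abs_prod]
  gcongr
  calc ∏ i, |x i ^ e i| ≤ ∏ i, Y ^ e i := by
        refine Finset.prod_le_prod (fun i _ => abs_nonneg _) fun i _ => ?_
        rw [abs_pow]
        exact pow_le_pow_left₀ (abs_nonneg _) (hx i) _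
    _ = Y ^ ∑ i, e i := Finset.prod_pow_eq_pow_sum _ _ _
    _ ≤ Y ^ p.totalDegree := by
        refine pow_le_pow_right₀ hY ?_
        have := MvPolynomial.le_totalDegree he
        rwa [Finsupp.sum_fintype _ _ (by simp)] at this

theorem exists_norm_wordDeriv_polyFun_le (k : ℕ) (p : MvPolynomial (Fin d) ℝ)
    (hp : p.totalDegree ≤ k) :
    ∃ C : ℝ, 0 ≤ C ∧ ∀ (w : List (Fin d)) (x : Rd d) (Y : ℝ), 1 ≤ Y → (∀ j, |x j| ≤ Y) →
      ‖wordDeriv w (polyFun p) x‖ ≤ C * Y ^ k := by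
  induction k generalizing p with
  | zero =>
    obtain ⟨C, hC, H⟩ := exists_norm_polyFun_le p
    refine ⟨C, hC, fun w x Y hY hx => ?_⟩
    rcases List.eq_nil_or_concat w with rfl | ⟨u, j, rfl⟩
    · rw [wordDeriv_nil]
      exact (H x Y hY hx).trans (by gcongr)
    · have h0 : MvPolynomial.pderiv j p = 0 := by
        rw [MvPolynomial.totalDegree_eq_zero_iff_eq_C.1 (Nat.le_zero.1 hp),
          MvPolynomial.pderiv_C]
      have h1 : polyFun (0 : MvPolynomial (Fin d) ℝ) = 0 := by funext x; simp [polyFun]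
      rw [List.concat_eq_append, wordDeriv_append, wordDeriv_cons, wordDeriv_nil,
        partialDeriv_polyFun, h0, h1, wordDeriv_zero]
      simpa using hC
  | succ k ih =>
    obtain ⟨C, hC, H⟩ := exists_norm_polyFun_le p
    choose D hD HD using fun j => ih (MvPolynomial.pderiv j p)
      ((totalDegree_pderiv_le j p).trans (by omega))
    have hDs : 0 ≤ ∑ j, D j := Finset.sum_nonneg fun j _ => hD j
    refine ⟨C + ∑ j, D j, by positivity, fun w x Y hY hx => ?_⟩
    have hY0 : 0 ≤ Y := by linarith
    rcases List.eq_nil_or_concat w with rfl | ⟨u, j, rfl⟩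
    · rw [wordDeriv_nil]
      exact (H x Y hY hx).trans (mul_le_mul (by linarith) (pow_le_pow_right₀ hY hp)
        (by positivity) (by positivity))
    · rw [List.concat_eq_append, wordDeriv_append, wordDeriv_cons, wordDeriv_nil,
        partialDeriv_polyFun]
      refine (HD j u x Y hY hx).trans (mul_le_mul ?_ (pow_le_pow_right₀ hY (by omega))
        (by positivity) (by positivity))
      have := Finset.single_le_sum (fun i _ => hD i) (Finset.mem_univ j)
      linarith

/-- The function `e^{iq}` on `ℝᵈ`. -/
def chirp (q : MvPolynomial (Fin d) ℝ) : Rd d → ℂ :=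
  fun x => Complex.exp (Complex.I * (MvPolynomial.eval (fun j => x j) q : ℝ))

theorem chirp_contDiff (q : MvPolynomial (Fin d) ℝ) : ContDiff ℝ ∞ (chirp q) :=
  (contDiff_const.mul (polyFun_contDiff q)).cexp

theorem norm_chirp (q : MvPolynomial (Fin d) ℝ) (x : Rd d) : ‖chirp q x‖ = 1 := by
  rw [chirp, mul_comm, Complex.norm_exp_ofReal_mul_I]

theorem partialDeriv_chirp (j : Fin d) (q : MvPolynomial (Fin d) ℝ) :
    partialDeriv j (chirp q) =
      (Complex.I • polyFun (MvPolynomial.pderiv j q)) * chirp q := by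
  funext x
  have h := (((polyFun_contDiff q).differentiable (by simp) x).hasFDerivAt.const_mul
    Complex.I).cexp
  rw [partialDeriv, show chirp q = fun x => Complex.exp (Complex.I * polyFun q x) from rfl,
    h.fderiv, ← partialDeriv_polyFun]
  simp [partialDeriv]
  ring

theorem exists_norm_wordDeriv_chirp_le (q : MvPolynomial (Fin d) ℝ) :
    ∃ K : ℝ, 1 ≤ K ∧ ∀ (w : List (Fin d)) (x : Rd d) (Y : ℝ), 1 ≤ Y → (∀ j, |x j| ≤ Y) →
      ‖wordDeriv w (chirp q) x‖ ≤
        (K * (Y ^ (q.totalDegree - 1) + w.length)) ^ w.length := by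
  choose C hC HC using fun j => exists_norm_wordDeriv_polyFun_le (q.totalDegree - 1)
    (MvPolynomial.pderiv j q) (totalDegree_pderiv_le j q)
  have hCs : 0 ≤ ∑ j, C j := Finset.sum_nonneg fun j _ => hC j
  refine ⟨1 + ∑ j, C j, by linarith, fun w x Y hY hx => ?_⟩
  set K := 1 + ∑ j, C j with hK
  set Z := Y ^ (q.totalDegree - 1) with hZ
  have hZ1 : 1 ≤ Z := one_le_pow₀ hY
  have hZ0 : 0 ≤ Z := by linarith
  have hK1 : 1 ≤ K := by linarith
  have hK0 : 0 ≤ K := by linarith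
  induction hn : w.length using Nat.strong_induction_on generalizing w with
  | _ n ih =>
  rcases List.eq_nil_or_concat w with rfl | ⟨u, j, rfl⟩
  · obtain rfl : n = 0 := by simpa using hn.symm
    rw [wordDeriv_nil, norm_chirp]
    simp
  · rw [List.concat_eq_append] at hn ⊢
    simp only [List.length_append, List.length_cons, List.length_nil, zero_add] at hn
    rw [wordDeriv_append, wordDeriv_cons, wordDeriv_nil, partialDeriv_chirp]
    have hCj : C j ≤ K := by
      have := Finset.single_le_sum (fun i _ => hC i) (Finset.mem_univ j)
      linarith
    have key := norm_wordDeriv_mul_le (f := Complex.I • polyFun (MvPolynomial.pderiv j q))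
      (contDiff_const.smul (polyFun_contDiff _))
      (chirp_contDiff q) u x (C j * Z) 1 (K * (Z + u.length)) ?_
    · refine key.trans ?_
      rw [← hn, pow_succ', Nat.cast_add, Nat.cast_one]
      have hu : (0 : ℝ) ≤ u.length := Nat.cast_nonneg _
      refine mul_le_mul (mul_le_mul hCj (by linarith) hZ0 hK0) ?_ (by positivity)
        (by positivity)
      exact pow_le_pow_left₀ (by positivity) (by linarith) _
    · intro p hp
      have hlen := length_add_of_mem_splits hp
      have h1 := HC j p.1 x Y hY hx
      have h2 := ih p.2.length (by omega) p.2 rfl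
      rw [wordDeriv_smul _ _ (polyFun_contDiff _), Pi.smul_apply, norm_smul, Complex.norm_I,
        one_mul, one_pow, one_mul]
      refine mul_le_mul h1 (h2.trans ?_) (norm_nonneg _) (mul_nonneg (hC j) hZ0)
      have h3 : (p.2.length : ℝ) ≤ u.length := by exact_mod_cast (by omega)
      gcongr

end Polynomials

section Factorials

theorem factorial_add_le (a b : ℕ) :
    (a + b).factorial ≤ 2 ^ (a + b) * (a.factorial * b.factorial) := by
  rw [← Nat.add_choose_mul_factorial_mul_factorial a b, mul_assoc]
  exact Nat.mul_le_mul_right _ (Nat.choose_le_two_pow _ _)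

theorem factorial_sum_le {ι : Type*} (S : Finset ι) (β : ι → ℕ) :
    (∑ j ∈ S, β j).factorial ≤ 2 ^ (S.card * ∑ j ∈ S, β j) * ∏ j ∈ S, (β j).factorial := by
  classical
  induction S using Finset.induction_on with
  | empty => simp
  | insert i S hi ih =>
    rw [Finset.sum_insert hi, Finset.prod_insert hi, Finset.card_insert_of_notMem hi]
    set n := ∑ j ∈ S, β j
    set P := ∏ j ∈ S, (β j).factorial
    calc (β i + n).factorial ≤ 2 ^ (β i + n) * ((β i).factorial * n.factorial) :=
          factorial_add_le _ _
      _ ≤ 2 ^ (β i + n) * ((β i).factorial * (2 ^ (S.card * n) * P)) := by gcongr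
      _ ≤ 2 ^ (β i + n) * ((β i).factorial * (2 ^ (S.card * (β i + n)) * P)) := by
          gcongr <;> omega
      _ = _ := by ring

theorem factorial_multiLength_le {d : ℕ} (β : Fin d → ℕ) :
    (multiLength β).factorial ≤ 2 ^ (d * multiLength β) * multiFactorial β := by
  simpa [multiLength, multiFactorial] using factorial_sum_le Finset.univ β

theorem multiFactorial_le {d : ℕ} (β : Fin d → ℕ) :
    multiFactorial β ≤ (multiLength β).factorial :=
  Nat.le_of_dvd (Nat.factorial_pos _) (Nat.prod_factorial_dvd_factorial_sum _ _)

theorem pow_self_le_exp_mul_factorial (n : ℕ) :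
    (n : ℝ) ^ n ≤ Real.exp 1 ^ n * n.factorial := by
  have h := Real.pow_div_factorial_le_exp (n : ℝ) (Nat.cast_nonneg n) n
  rwa [div_le_iff₀ (by positivity), ← Real.exp_one_pow n] at h

theorem factorial_mul_rpow_le {θ s : ℝ} (hθ : 0 ≤ θ) (k : ℕ) (hk : k * θ ≤ s) (n : ℕ) :
    ((k * n).factorial : ℝ) ^ θ ≤
      (((k + 1) * Real.exp 1) ^ (k * θ)) ^ n * (n.factorial : ℝ) ^ s := by
  have he : 0 < Real.exp 1 := Real.exp_pos 1
  have h1 : ((k * n).factorial : ℝ) ≤ ((((k + 1) * Real.exp 1) ^ n * n.factorial) ^ k) := by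
    have h2 : ((k * n).factorial : ℝ) ≤ ((k * n : ℕ) : ℝ) ^ (k * n) := by
      exact_mod_cast Nat.factorial_le_pow _
    refine h2.trans ?_
    rw [mul_comm k n, pow_mul]
    refine pow_le_pow_left₀ (by positivity) ?_ k
    rw [Nat.cast_mul, mul_comm, mul_pow, mul_pow, mul_assoc]
    refine mul_le_mul (pow_le_pow_left₀ (by positivity) (by linarith) n)
      (pow_self_le_exp_mul_factorial n) (by positivity) (by positivity)
  refine (Real.rpow_le_rpow (by positivity) h1 hθ).trans ?_
  rw [← Real.rpow_natCast _ k, ← Real.rpow_mul (by positivity),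
    Real.mul_rpow (by positivity) (by positivity), ← Real.rpow_natCast _ n,
    ← Real.rpow_natCast _ n, ← Real.rpow_mul (by positivity), ← Real.rpow_mul (by positivity),
    mul_comm (n : ℝ)]
  gcongr
  exact_mod_cast Nat.one_le_iff_ne_zero.2 (Nat.factorial_ne_zero n)

end Factorials

section Estimates

variable {d : ℕ} {θ s : ℝ}

theorem le_norm_mul_of_mem_step {h : Set.Ioi (0 : ℝ)} (f : StepSpace d θ s h)
    (α β : Fin d → ℕ) (x : Rd d) :
    |multiPow x α| * ‖multiDeriv β f.1 x‖ ≤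
      ‖f‖ * ((h : ℝ) ^ multiLength (α + β) * (multiFactorial α : ℝ) ^ θ *
        (multiFactorial β : ℝ) ^ s) := by
  rw [← div_le_iff₀ (gsDenominator_pos θ s h.2 α β)]
  exact le_ciSup f.2.2 (α, β, x)

theorem multiLength_add (α β : Fin d → ℕ) :
    multiLength (α + β) = multiLength α + multiLength β := by
  simp [multiLength, Finset.sum_add_distrib]

theorem le_norm_mul_of_sorted (hs : 0 ≤ s) {h : Set.Ioi (0 : ℝ)} (f : StepSpace d θ s h)
    (α : Fin d → ℕ) {v : List (Fin d)} (hv : v.Pairwise (· ≤ ·)) (x : Rd d) :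
    |multiPow x α| * ‖wordDeriv v f.1 x‖ ≤
      ‖f‖ * (h : ℝ) ^ multiLength α * (h : ℝ) ^ v.length * (v.length.factorial : ℝ) ^ s *
        (multiFactorial α : ℝ) ^ θ := by
  have hh : (0 : ℝ) < h := h.2
  rw [wordDeriv_of_sorted hv]
  refine (le_norm_mul_of_mem_step f α _ x).trans ?_
  have h1 : (multiFactorial fun j => v.count j : ℝ) ^ s ≤ (v.length.factorial : ℝ) ^ s := by
    refine Real.rpow_le_rpow (Nat.cast_nonneg _) ?_ hs
    rw [length_eq_multiLength_count v]
    exact_mod_cast multiFactorial_le _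
  rw [multiLength_add, ← length_eq_multiLength_count v, pow_add]
  calc _ ≤ ‖f‖ * ((h : ℝ) ^ multiLength α * (h : ℝ) ^ v.length * (multiFactorial α : ℝ) ^ θ *
        (v.length.factorial : ℝ) ^ s) := by gcongr
    _ = _ := by ring

theorem multiPow_add_single (x : Rd d) (α : Fin d → ℕ) (j : Fin d) (N : ℕ) :
    multiPow x (α + Pi.single j N) = multiPow x α * x j ^ N := by
  simp only [multiPow, Pi.add_apply, pow_add, Finset.prod_mul_distrib]
  congr 1
  rw [Finset.prod_eq_single j (fun i _ hi => by simp [hi]) (by simp)]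
  simp

theorem multiFactorial_add_single_le (α : Fin d → ℕ) (j : Fin d) (N : ℕ) :
    multiFactorial (α + Pi.single j N) ≤
      2 ^ multiLength α * 2 ^ N * (multiFactorial α * N.factorial) := by
  have hα : α j ≤ multiLength α := Finset.single_le_sum (fun _ _ => Nat.zero_le _)
    (Finset.mem_univ j)
  have h1 : ∀ γ : Fin d → ℕ, multiFactorial γ =
      (γ j).factorial * ∏ i ∈ Finset.univ.erase j, (γ i).factorial :=
    fun γ => (Finset.mul_prod_erase _ _ (Finset.mem_univ j)).symm
  rw [h1, h1 α]
  have h2 : ∏ i ∈ Finset.univ.erase j, ((α + Pi.single j N : Fin d → ℕ) i).factorial =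
      ∏ i ∈ Finset.univ.erase j, (α i).factorial :=
    Finset.prod_congr rfl fun i hi => by simp [Finset.ne_of_mem_erase hi]
  rw [h2]
  set P := ∏ i ∈ Finset.univ.erase j, (α i).factorial
  simp only [Pi.add_apply, Pi.single_eq_same]
  calc (α j + N).factorial * P ≤ 2 ^ (α j + N) * ((α j).factorial * N.factorial) * P := by
        gcongr
        exact factorial_add_le _ _
    _ ≤ 2 ^ (multiLength α + N) * ((α j).factorial * N.factorial) * P := by
        gcongr
        norm_num
    _ = _ := by ring

theorem exists_dominating (x : Rd d) :
    ∃ Y : ℝ, 1 ≤ Y ∧ (∀ j, |x j| ≤ Y) ∧ (Y = 1 ∨ ∃ j, Y = |x j|) := by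
  by_cases H : ∀ j, |x j| ≤ 1
  · exact ⟨1, le_rfl, H, Or.inl rfl⟩
  · push Not at H
    obtain ⟨i, hi⟩ := H
    obtain ⟨j, -, hj⟩ := Finset.exists_max_image Finset.univ (fun j => |x j|)
      ⟨i, Finset.mem_univ i⟩
    exact ⟨|x j|, hi.le.trans (hj i (Finset.mem_univ i)), fun k => hj k (Finset.mem_univ k),
      Or.inr ⟨j, rfl⟩⟩

theorem pow_mul_le_norm_mul_of_sorted (hθ : 0 ≤ θ) (hs : 0 ≤ s) {h : Set.Ioi (0 : ℝ)}
    (f : StepSpace d θ s h) (α : Fin d → ℕ) {v : List (Fin d)} (hv : v.Pairwise (· ≤ ·))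
    (x : Rd d) {Y : ℝ} (hY : Y = 1 ∨ ∃ j, Y = |x j|) (N : ℕ) :
    Y ^ N * (|multiPow x α| * ‖wordDeriv v f.1 x‖) ≤
      ‖f‖ * (multiFactorial α : ℝ) ^ θ * ((2 ^ θ) * (h : ℝ)) ^ multiLength α *
        ((h : ℝ) ^ v.length * (v.length.factorial : ℝ) ^ s) *
        (1 + (h : ℝ) ^ N * (2 ^ θ) ^ N * (N.factorial : ℝ) ^ θ) := by
  have hh : (0 : ℝ) < h := h.2
  have h2 : (1 : ℝ) ≤ 2 ^ θ := Real.one_le_rpow (by norm_num) hθ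
  have h2a : (1 : ℝ) ≤ (2 ^ θ) ^ multiLength α := one_le_pow₀ h2
  rw [mul_pow]
  rcases hY with rfl | ⟨j, rfl⟩
  · rw [one_pow, one_mul]
    refine (le_norm_mul_of_sorted hs f α hv x).trans ?_
    calc _ = ‖f‖ * (multiFactorial α : ℝ) ^ θ * (1 * (h : ℝ) ^ multiLength α) *
        ((h : ℝ) ^ v.length * (v.length.factorial : ℝ) ^ s) * (1 + 0) := by ring
      _ ≤ _ := by
        gcongr
        positivity
  · have h3 : |x j| ^ N * (|multiPow x α| * ‖wordDeriv v f.1 x‖) =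
        |multiPow x (α + Pi.single j N)| * ‖wordDeriv v f.1 x‖ := by
      rw [multiPow_add_single, abs_mul, abs_pow]
      ring
    have h4 : multiLength (Pi.single j N) = N := by simp [multiLength]
    have h5 : (multiFactorial (α + Pi.single j N) : ℝ) ^ θ ≤
        (2 ^ θ) ^ multiLength α * (2 ^ θ) ^ N *
          ((multiFactorial α : ℝ) ^ θ * (N.factorial : ℝ) ^ θ) := by
      have h6 : (multiFactorial (α + Pi.single j N) : ℝ) ≤
          2 ^ multiLength α * 2 ^ N * (multiFactorial α * N.factorial) := by
        exact_mod_cast multiFactorial_add_single_le α j N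
      refine (Real.rpow_le_rpow (Nat.cast_nonneg _) h6 hθ).trans_eq ?_
      rw [Real.mul_rpow (by positivity) (by positivity),
        Real.mul_rpow (by positivity) (by positivity),
        Real.mul_rpow (by positivity) (by positivity),
        Real.rpow_pow_comm (by norm_num), Real.rpow_pow_comm (by norm_num)]
    rw [h3]
    refine (le_norm_mul_of_sorted hs f _ hv x).trans ?_
    rw [multiLength_add, h4, pow_add]
    calc _ ≤ ‖f‖ * ((h : ℝ) ^ multiLength α * (h : ℝ) ^ N) * (h : ℝ) ^ v.length *
          (v.length.factorial : ℝ) ^ s * ((2 ^ θ) ^ multiLength α * (2 ^ θ) ^ N *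
          ((multiFactorial α : ℝ) ^ θ * (N.factorial : ℝ) ^ θ)) := by gcongr
      _ = ‖f‖ * (multiFactorial α : ℝ) ^ θ * ((2 ^ θ) ^ multiLength α * (h : ℝ) ^ multiLength α) *
        ((h : ℝ) ^ v.length * (v.length.factorial : ℝ) ^ s) *
        (0 + (h : ℝ) ^ N * (2 ^ θ) ^ N * (N.factorial : ℝ) ^ θ) := by ring
      _ ≤ _ := by
        gcongr
        norm_num

/-- The weighted bound for the derivatives of `e^{iq} f` in terms of those of `f`. -/
theorem exists_gsQuotient_chirp_mul_le (q : MvPolynomial (Fin d) ℝ) (hθ : 0 ≤ θ) (hs : 0 ≤ s)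
    (hm : ((q.totalDegree - 1 : ℕ) : ℝ) * θ ≤ s) :
    ∃ A B : ℝ, 0 < A ∧ 0 < B ∧ ∀ (h : Set.Ioi (0 : ℝ)) (ρ C h' : ℝ), 0 ≤ ρ → 0 ≤ C → 0 < h' →
      (∀ n : ℕ, 2 * (A ^ n * n.factorial) + ((h : ℝ) ^ (q.totalDegree - 1) * B) ^ n *
        (n.factorial : ℝ) ^ s ≤ C * (ρ ^ n * (n.factorial : ℝ) ^ s)) →
      2 ^ θ * (h : ℝ) ≤ h' → (2 ^ d) ^ s * (ρ + h) ≤ h' →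
      ∀ (f : StepSpace d θ s h) (p : (Fin d → ℕ) × (Fin d → ℕ) × Rd d),
        gsQuotient θ s h' (chirp q * f.1) p ≤ C * ‖f‖ := by
  obtain ⟨K, hK1, HK⟩ := exists_norm_wordDeriv_chirp_le q
  generalize q.totalDegree - 1 = k at *
  have he : 1 ≤ Real.exp 1 := Real.one_le_exp (by norm_num)
  set e := Real.exp 1 with he'
  set b : ℝ := ((k + 1) * e) ^ (k * θ) with hb
  have hb0 : 0 < b := by positivity
  have hK0 : 0 < K := by linarith
  refine ⟨2 * K * e, 2 * K * ((2 ^ θ) ^ k * b), by positivity, by positivity, ?_⟩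
  rintro h ρ C h' hρ hC hh' H h1 h2 f ⟨α, β, x⟩
  have hh : (0 : ℝ) < h := h.2
  obtain ⟨Y, hY1, hYx, hY⟩ := exists_dominating x
  have hY0 : 0 ≤ Y := by linarith
  rw [gsQuotient, div_le_iff₀ (gsDenominator_pos θ s hh' α β)]
  dsimp only
  set W := ‖f‖ * (multiFactorial α : ℝ) ^ θ * ((2 ^ θ) * (h : ℝ)) ^ multiLength α with hW
  have hW0 : 0 ≤ W := by positivity
  have term : ∀ p ∈ splits (indexWord β),
      ‖wordDeriv p.1 (chirp q) x‖ * ‖wordDeriv p.2 (((|multiPow x α| : ℝ) : ℂ) • f.1) x‖ ≤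
      (C * W * ((multiLength β).factorial : ℝ) ^ s) * (ρ ^ p.1.length * (h : ℝ) ^ p.2.length) := by
    intro p hp
    have hv := (indexWord_sorted β).sublist (sublist_of_mem_splits hp)
    have hlen := length_add_of_mem_splits hp
    rw [length_indexWord] at hlen
    have hE := HK p.1 x Y hY1 hYx
    rw [wordDeriv_smul _ _ f.2.1, Pi.smul_apply, norm_smul, Complex.norm_real, Real.norm_eq_abs,
      abs_abs]
    set n := p.1.length with hn
    set l := p.2.length with hl
    have hF := fun N => pow_mul_le_norm_mul_of_sorted hθ hs f α hv x hY N
    rw [← hW, ← hl] at hF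
    set F := |multiPow x α| * ‖wordDeriv p.2 f.1 x‖
    have hF0 : 0 ≤ F := by positivity
    set V := W * ((h : ℝ) ^ l * (l.factorial : ℝ) ^ s) with hV
    have hV0 : 0 ≤ V := by positivity
    have hpow : (K * (Y ^ k + n)) ^ n ≤ (2 * K) ^ n * (Y ^ (k * n) + (n : ℝ) ^ n) := by
      have h3 := add_pow_le (pow_nonneg hY0 k) (Nat.cast_nonneg (α := ℝ) n) n
      have h4 : (2 : ℝ) ^ (n - 1) ≤ 2 ^ n := pow_le_pow_right₀ (by norm_num) (by omega)
      rw [mul_pow, mul_pow, pow_mul, mul_comm (2 ^ n), mul_assoc]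
      gcongr
      refine h3.trans ?_
      gcongr
    have hN := factorial_mul_rpow_le hθ k hm n
    rw [← he', ← hb] at hN
    have hn1 : (1 : ℝ) ≤ n.factorial := by
      exact_mod_cast Nat.one_le_iff_ne_zero.2 (Nat.factorial_ne_zero n)
    have hen : 1 ≤ e ^ n * n.factorial := by
      nlinarith [one_le_pow₀ he (n := n)]
    have hself := pow_self_le_exp_mul_factorial n
    have h0 : F ≤ V := by
      have := le_norm_mul_of_sorted hs f α hv x
      have h2a : (1 : ℝ) ≤ (2 ^ θ) ^ multiLength α :=
        one_le_pow₀ (Real.one_le_rpow (by norm_num) hθ)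
      refine this.trans ?_
      rw [hV, hW, mul_pow]
      calc _ = ‖f‖ * (multiFactorial α : ℝ) ^ θ * (1 * (h : ℝ) ^ multiLength α) *
            ((h : ℝ) ^ l * (l.factorial : ℝ) ^ s) := by ring
        _ ≤ _ := by gcongr
    calc ‖wordDeriv p.1 (chirp q) x‖ * F
        ≤ (2 * K) ^ n * (Y ^ (k * n) + (n : ℝ) ^ n) * F := by
          gcongr
          exact hE.trans hpow
      _ = (2 * K) ^ n * (Y ^ (k * n) * F + (n : ℝ) ^ n * F) := by ring
      _ ≤ (2 * K) ^ n * (V * (1 + (h : ℝ) ^ (k * n) * (2 ^ θ) ^ (k * n) *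
            (b ^ n * (n.factorial : ℝ) ^ s)) + (e ^ n * n.factorial) * V) := by
          have h5 := hF (k * n)
          have h6 : V * (1 + (h : ℝ) ^ (k * n) * (2 ^ θ) ^ (k * n) *
              ((k * n).factorial : ℝ) ^ θ) ≤ V * (1 + (h : ℝ) ^ (k * n) * (2 ^ θ) ^ (k * n) *
              (b ^ n * (n.factorial : ℝ) ^ s)) := by gcongr
          have h7 := mul_le_mul hself h0 hF0 (by positivity)
          exact mul_le_mul_of_nonneg_left (add_le_add (h5.trans h6) h7) (by positivity)
      _ ≤ (2 * K) ^ n * (V * (e ^ n * n.factorial + (h : ℝ) ^ (k * n) * (2 ^ θ) ^ (k * n) *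
            (b ^ n * (n.factorial : ℝ) ^ s)) + (e ^ n * n.factorial) * V) := by gcongr
      _ = V * (2 * ((2 * K * e) ^ n * n.factorial) +
            ((h : ℝ) ^ k * (2 * K * ((2 ^ θ) ^ k * b))) ^ n * (n.factorial : ℝ) ^ s) := by
          simp only [mul_pow, pow_mul]
          ring
      _ ≤ V * (C * (ρ ^ n * (n.factorial : ℝ) ^ s)) := by
          gcongr
          exact H n
      _ = C * W * ((n.factorial : ℝ) ^ s * (l.factorial : ℝ) ^ s) * (ρ ^ n * (h : ℝ) ^ l) := by
          rw [hV]; ring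
      _ ≤ _ := by
          gcongr
          rw [← Real.mul_rpow (by positivity) (by positivity), ← hlen]
          refine Real.rpow_le_rpow (by positivity) ?_ hs
          exact_mod_cast Nat.le_of_dvd (Nat.factorial_pos _)
            (Nat.factorial_mul_factorial_dvd_factorial_add n l)
  have total := norm_wordDeriv_mul_le (chirp_contDiff q) (g := ((|multiPow x α| : ℝ) : ℂ) • f.1)
    (contDiff_const.smul f.2.1) (indexWord β) x _ _ _ term
  have hα : ((2 ^ θ) * (h : ℝ)) ^ multiLength α ≤ h' ^ multiLength α :=
    pow_le_pow_left₀ (by positivity) h1 _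
  have hβ : ((multiLength β).factorial : ℝ) ^ s * (ρ + h) ^ multiLength β ≤
      (multiFactorial β : ℝ) ^ s * h' ^ multiLength β := by
    have h3 : ((multiLength β).factorial : ℝ) ≤ (2 ^ d) ^ multiLength β * multiFactorial β := by
      rw [← pow_mul]
      exact_mod_cast factorial_multiLength_le β
    have h4 := Real.rpow_le_rpow (by positivity) h3 hs
    rw [Real.mul_rpow (by positivity) (by positivity), ← Real.rpow_pow_comm (by positivity)] at h4
    calc _ ≤ ((2 ^ d : ℝ) ^ s) ^ multiLength β * (multiFactorial β : ℝ) ^ s *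
          (ρ + h) ^ multiLength β := by gcongr
      _ = (multiFactorial β : ℝ) ^ s * ((2 ^ d) ^ s * (ρ + h)) ^ multiLength β := by
          rw [mul_pow]; ring
      _ ≤ _ := by gcongr
  have hsm : chirp q * (((|multiPow x α| : ℝ) : ℂ) • f.1) =
      ((|multiPow x α| : ℝ) : ℂ) • (chirp q * f.1) := by
    rw [mul_smul_comm]
  have hprod : ContDiff ℝ ∞ (chirp q * f.1) := (chirp_contDiff q).mul f.2.1
  rw [hsm, wordDeriv_smul _ _ hprod, wordDeriv_indexWord, Pi.smul_apply,
    norm_smul, Complex.norm_real, Real.norm_eq_abs, abs_abs, length_indexWord] at total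
  refine total.trans ?_
  rw [multiLength_add, pow_add]
  calc _ = C * W * (((multiLength β).factorial : ℝ) ^ s * (ρ + h) ^ multiLength β) := by ring
    _ ≤ C * (‖f‖ * (multiFactorial α : ℝ) ^ θ * h' ^ multiLength α) *
        ((multiFactorial β : ℝ) ^ s * h' ^ multiLength β) := by
        rw [hW]
        gcongr
    _ = _ := by ring

end Estimates

section Multiplication

variable {d : ℕ} {θ s : ℝ}

theorem one_le_factorial (n : ℕ) : (1 : ℝ) ≤ n.factorial := by
  exact_mod_cast Nat.one_le_iff_ne_zero.2 (Nat.factorial_ne_zero n)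

/-- Multiplication by `e^{iq}` maps each step of the Roumieu space boundedly into another one. -/
theorem exists_step_bound_of_step (q : MvPolynomial (Fin d) ℝ) (hθ : 0 ≤ θ) (hs : 1 ≤ s)
    (hm : ((q.totalDegree - 1 : ℕ) : ℝ) * θ ≤ s) (h : Set.Ioi (0 : ℝ)) :
    ∃ (h' : Set.Ioi (0 : ℝ)) (C : ℝ), ∀ (f : StepSpace d θ s h) p,
      gsQuotient θ s h' (chirp q * f.1) p ≤ C * ‖f‖ := by
  obtain ⟨A, B, hA, hB, H⟩ := exists_gsQuotient_chirp_mul_le (d := d) q hθ (by linarith) hm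
  have hh : (0 : ℝ) < h := h.2
  set D := (h : ℝ) ^ (q.totalDegree - 1) * B with hD
  have hD0 : 0 < D := by positivity
  set h' := max (2 ^ θ * (h : ℝ)) ((2 ^ d) ^ s * (max A D + h)) with hh'
  have hh'0 : 0 < h' := lt_max_of_lt_left (by positivity)
  refine ⟨⟨h', hh'0⟩, 3, H h (max A D) 3 h' (by positivity) (by norm_num) hh'0 (fun n => ?_)
    (le_max_left _ _) (le_max_right _ _)⟩
  have h1 : (n.factorial : ℝ) ≤ (n.factorial : ℝ) ^ s :=
    Real.self_le_rpow_of_one_le (one_le_factorial n) hs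
  have h2 : A ^ n * n.factorial ≤ max A D ^ n * (n.factorial : ℝ) ^ s := by
    gcongr
    exact le_max_left _ _
  have h3 : D ^ n * (n.factorial : ℝ) ^ s ≤ max A D ^ n * (n.factorial : ℝ) ^ s := by
    gcongr
    exact le_max_right _ _
  rw [← hD]
  linarith

theorem exists_pow_mul_factorial_le {A ρ : ℝ} (hA : 0 < A) (hρ : 0 < ρ) (hs : 1 < s) :
    ∃ C : ℝ, 0 ≤ C ∧ ∀ n : ℕ, A ^ n * n.factorial ≤ C * (ρ ^ n * (n.factorial : ℝ) ^ s) := by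
  set a := (A / ρ) ^ (1 / (s - 1)) with ha
  have hs1 : 0 < s - 1 := by linarith
  have ha0 : 0 < a := by positivity
  refine ⟨Real.exp a ^ (s - 1), by positivity, fun n => ?_⟩
  have hn := one_le_factorial n
  have h1 := Real.pow_div_factorial_le_exp a ha0.le n
  rw [div_le_iff₀ (by positivity)] at h1
  have h2 := Real.rpow_le_rpow (by positivity) h1 hs1.le
  have h3 : (a ^ n) ^ (s - 1) = (A / ρ) ^ n := by
    rw [← Real.rpow_pow_comm ha0.le, ha, ← Real.rpow_mul (by positivity),
      one_div_mul_cancel hs1.ne', Real.rpow_one]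
  rw [h3, Real.mul_rpow (by positivity) (by positivity), div_pow, div_le_iff₀ (by positivity)] at h2
  have h4 : (n.factorial : ℝ) ^ s = (n.factorial : ℝ) ^ (s - 1) * n.factorial := by
    rw [← Real.rpow_add_one (by positivity)]
    ring_nf
  rw [h4]
  calc A ^ n * n.factorial
      ≤ Real.exp a ^ (s - 1) * (n.factorial : ℝ) ^ (s - 1) * ρ ^ n * n.factorial := by gcongr
    _ = _ := by ring

/-- Multiplication by `e^{iq}` maps some step of the Beurling space boundedly into a given one. -/
theorem exists_step_bound_to_step (q : MvPolynomial (Fin d) ℝ) (hq : 2 ≤ q.totalDegree)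
    (hθ : 0 ≤ θ) (hs : 1 < s) (hm : ((q.totalDegree - 1 : ℕ) : ℝ) * θ ≤ s)
    (h' : Set.Ioi (0 : ℝ)) :
    ∃ (h : Set.Ioi (0 : ℝ)) (C : ℝ), ∀ (f : StepSpace d θ s h) p,
      gsQuotient θ s h' (chirp q * f.1) p ≤ C * ‖f‖ := by
  obtain ⟨A, B, hA, hB, H⟩ := exists_gsQuotient_chirp_mul_le (d := d) q hθ (by linarith) hm
  have hh' : (0 : ℝ) < h' := h'.2
  have hM : (0 : ℝ) < (2 ^ d) ^ s := by positivity
  set ρ := (h' : ℝ) / (2 * (2 ^ d) ^ s) with hρ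
  have hρ0 : 0 < ρ := by positivity
  obtain ⟨C, hC, HC⟩ := exists_pow_mul_factorial_le hA hρ0 hs
  set h := min (min 1 ((h' : ℝ) / 2 ^ θ)) (min ρ (ρ / B)) with hh
  have h1 : h ≤ 1 := (min_le_left _ _).trans (min_le_left _ _)
  have h2 : h ≤ (h' : ℝ) / 2 ^ θ := (min_le_left _ _).trans (min_le_right _ _)
  have h3 : h ≤ ρ := (min_le_right _ _).trans (min_le_left _ _)
  have h4 : h ≤ ρ / B := (min_le_right _ _).trans (min_le_right _ _)
  have h0 : 0 < h := by
    refine lt_min (lt_min one_pos ?_) (lt_min hρ0 ?_) <;> positivity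
  refine ⟨⟨h, h0⟩, 2 * C + 1, H ⟨h, h0⟩ ρ (2 * C + 1) h' hρ0.le (by linarith) hh' (fun n => ?_)
    ?_ ?_⟩
  · have h5 : h ^ (q.totalDegree - 1) * B ≤ ρ := by
      rw [← le_div_iff₀ hB]
      exact (pow_le_of_le_one h0.le h1 (by omega)).trans h4
    have h6 : (h ^ (q.totalDegree - 1) * B) ^ n * (n.factorial : ℝ) ^ s ≤
        ρ ^ n * (n.factorial : ℝ) ^ s := by gcongr
    have := HC n
    change 2 * (A ^ n * n.factorial) + (h ^ (q.totalDegree - 1) * B) ^ n *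
      (n.factorial : ℝ) ^ s ≤ _
    linarith
  · change 2 ^ θ * h ≤ _
    rw [le_div_iff₀ (by positivity)] at h2
    linarith
  · change (2 ^ d) ^ s * (ρ + h) ≤ _
    calc (2 ^ d : ℝ) ^ s * (ρ + h) ≤ (2 ^ d) ^ s * (ρ + ρ) := by gcongr
      _ = h' := by rw [hρ]; field_simp; ring

/-- The linear map between steps given by multiplication by a smooth function `g`. -/
def mulStep (g : Rd d → ℂ) (hg : ContDiff ℝ ∞ g) {h h' : Set.Ioi (0 : ℝ)} {C : ℝ}
    (H : ∀ (f : StepSpace d θ s h) p, gsQuotient θ s h' (g * f.1) p ≤ C * ‖f‖) :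
    StepSpace d θ s h →ₗ[ℂ] StepSpace d θ s h' where
  toFun f := ⟨g * f.1, hg.mul f.2.1, C * ‖f‖, by rintro _ ⟨p, rfl⟩; exact H f p⟩
  map_add' f₁ f₂ := Subtype.ext (mul_add g f₁.1 f₂.1)
  map_smul' c f := Subtype.ext (mul_smul_comm c g f.1)

theorem mulStep_continuous (g : Rd d → ℂ) (hg : ContDiff ℝ ∞ g) {h h' : Set.Ioi (0 : ℝ)} {C : ℝ}
    (H : ∀ (f : StepSpace d θ s h) p, gsQuotient θ s h' (g * f.1) p ≤ C * ‖f‖) :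
    Continuous (mulStep g hg H) :=
  AddMonoidHomClass.continuous_of_bound (mulStep g hg H) C fun f => ciSup_le fun p => H f p

/-- Multiplication by a smooth function that maps each step boundedly into another one is a
continuous operator on the Roumieu space. -/
theorem exists_roumieu_mul (g : Rd d → ℂ) (hg : ContDiff ℝ ∞ g)
    (H : ∀ h : Set.Ioi (0 : ℝ), ∃ (h' : Set.Ioi (0 : ℝ)) (C : ℝ), ∀ (f : StepSpace d θ s h) p,
      gsQuotient θ s h' (g * f.1) p ≤ C * ‖f‖) :
    ∃ T : RoumieuSpace d θ s →L[ℂ] RoumieuSpace d θ s, ∀ f x, T f x = g x * f x := by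
  choose k C HC using H
  have hmem : ∀ f : Rd d → ℂ, f ∈ roumieuSubmodule d θ s → g * f ∈ roumieuSubmodule d θ s := by
    intro f hf
    obtain ⟨h, hf⟩ := Set.mem_iUnion.1 hf
    exact Set.mem_iUnion.2 ⟨k h, (mulStep g hg (HC h) ⟨f, hf⟩).2⟩
  let T : RoumieuSpace d θ s →ₗ[ℂ] RoumieuSpace d θ s :=
    { toFun := fun f => ⟨g * f.1, hmem f.1 f.2⟩
      map_add' := fun f₁ f₂ => Subtype.ext (mul_add g f₁.1 f₂.1)
      map_smul' := fun c f => Subtype.ext (mul_smul_comm c g f.1) }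
  refine ⟨⟨T, ?_⟩, fun f x => rfl⟩
  refine continuous_sInf_rng.2 fun t ht => ?_
  obtain ⟨ht1, ht2, ht3, ht4⟩ := ht
  rw [continuous_iff_le_induced]
  refine sInf_le ⟨fun h => ?_, ?_, ?_, ?_⟩
  · rw [continuous_induced_rng]
    exact (ht1 (k h)).comp (mulStep_continuous g hg (HC h))
  · exact topologicalAddGroup_induced T
  · exact continuousSMul_induced T
  · exact LocallyConvexSpace.induced (𝕜 := ℝ) (T.restrictScalars ℝ)

/-- Multiplication by a smooth function that maps some step boundedly into any given one is a
continuous operator on the Beurling space. -/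
theorem exists_beurling_mul (g : Rd d → ℂ) (hg : ContDiff ℝ ∞ g)
    (H : ∀ h' : Set.Ioi (0 : ℝ), ∃ (h : Set.Ioi (0 : ℝ)) (C : ℝ), ∀ (f : StepSpace d θ s h) p,
      gsQuotient θ s h' (g * f.1) p ≤ C * ‖f‖) :
    ∃ T : BeurlingSpace d θ s →L[ℂ] BeurlingSpace d θ s, ∀ f x, T f x = g x * f x := by
  choose k C HC using H
  have hmem : ∀ f : Rd d → ℂ, f ∈ beurlingSubmodule d θ s → g * f ∈ beurlingSubmodule d θ s := by
    intro f hf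
    refine (Submodule.mem_iInf _).2 fun h => ?_
    exact (mulStep g hg (HC h) ⟨f, (Submodule.mem_iInf _).1 hf (k h)⟩).2
  let T : BeurlingSpace d θ s →ₗ[ℂ] BeurlingSpace d θ s :=
    { toFun := fun f => ⟨g * f.1, hmem f.1 f.2⟩
      map_add' := fun f₁ f₂ => Subtype.ext (mul_add g f₁.1 f₂.1)
      map_smul' := fun c f => Subtype.ext (mul_smul_comm c g f.1) }
  refine ⟨⟨T, ?_⟩, fun f x => rfl⟩
  refine continuous_iInf_rng.2 fun h => continuous_induced_rng.2 ?_
  have hproj : Continuous (beurlingToStep d θ s (k h)) :=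
    continuous_iInf_dom (i := k h) continuous_induced_dom
  exact (mulStep_continuous g hg (HC h)).comp hproj

end Multiplication

end GelfandShilov

end

theorem theorem1p1 (d m : ℕ) (hm : 2 ≤ m) (q : MvPolynomial (Fin d) ℝ) (hq : q.totalDegree = m)
    (θ s : ℝ) (hθ : 0 < θ) (hs : 0 < s) :
    (((m : ℝ) - 1) * θ ≤ s → 1 ≤ ((m : ℝ) - 1) * θ →
      ∃ T : GelfandShilov.RoumieuSpace d θ s →L[ℂ] GelfandShilov.RoumieuSpace d θ s,
        ∀ (f : GelfandShilov.RoumieuSpace d θ s) (x : EuclideanSpace ℝ (Fin d)),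
          T f x = Complex.exp (Complex.I * (MvPolynomial.eval (fun j => x j) q : ℝ)) * f x) ∧
    (((m : ℝ) - 1) * θ ≤ s → 1 ≤ ((m : ℝ) - 1) * θ → (θ, s) ≠ (1 / ((m : ℝ) - 1), 1) →
      ∃ T : GelfandShilov.BeurlingSpace d θ s →L[ℂ] GelfandShilov.BeurlingSpace d θ s,
        ∀ (f : GelfandShilov.BeurlingSpace d θ s) (x : EuclideanSpace ℝ (Fin d)),
          T f x = Complex.exp (Complex.I * (MvPolynomial.eval (fun j => x j) q : ℝ)) * f x) := by
  subst hq
  have hcast : ((q.totalDegree - 1 : ℕ) : ℝ) = (q.totalDegree : ℝ) - 1 := by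
    rw [Nat.cast_sub (by omega), Nat.cast_one]
  have hm2 : (2 : ℝ) ≤ q.totalDegree := by exact_mod_cast hm
  rw [← hcast]
  refine ⟨fun h1 h2 => ?_, fun h1 h2 h3 => ?_⟩
  · exact GelfandShilov.exists_roumieu_mul _ (GelfandShilov.chirp_contDiff q) fun h =>
      GelfandShilov.exists_step_bound_of_step q hθ.le (h2.trans h1) h1 h
  · have hs1 : 1 < s := by
      refine lt_of_le_of_ne (h2.trans h1) fun h4 => h3 ?_
      subst h4
      have h5 := le_antisymm h1 h2
      rw [Prod.mk.injEq, eq_div_iff (by rw [hcast]; linarith), mul_comm]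
      exact ⟨h5, rfl⟩
    exact GelfandShilov.exists_beurling_mul _ (GelfandShilov.chirp_contDiff q) fun h =>
      GelfandShilov.exists_step_bound_to_step q hm hθ.le hs1 h1 h
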